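/- For a matrix $M$ with entries in $\{0,1\}$ having $m$ rows and $n$ columns ($m,n\ge 1$), let $|M|$ be the number of its entries equal to $1$ and let $p(M)=\frac{|M|}{mn}$ be its density. For a set $X$ of rows and a set $Y$ of columns, let $M[X\times Y]$ denote the submatrix of $M$ induced by the rows in $X$ and the columns in $Y$. The rank of $M$ is its rank over $\mathbb{R}$. There exists an absolute constant $c>0$ such that the following holds for all positive integers $n$ and $r$. Let $M\in\{0,1\}^{n\times n}$ be a matrix with $\operatorname{rank}(M)\le r$ whose density $p=p(M)$ satisfies $\frac{1}{8r}\le p\le \frac12$. Then there exist $X,Y\subseteq\{1,\dots,n\}$ such that $|X|=|Y|=\lfloor n/2\rfloor$ and $$p(M[X\times Y])\le p-c\,\frac{p^{1/2}}{\sqrt r}.$$ (The hypotheses force $n\ge 2$, so that $\lfloor n/2\rfloor\ge 1$.) -/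

import Mathlib

/-- A real matrix is binary if all its entries are `0` or `1`. -/
def Matrix.IsBinary {α β : Type*} (M : Matrix α β ℝ) : Prop :=
  ∀ i j, M i j = 0 ∨ M i j = 1

/-- The number `|M|` of entries of `M` that are equal to `1`. -/
noncomputable def Matrix.numOnes {α β : Type*} (M : Matrix α β ℝ) : ℕ :=
  Nat.card {e : α × β // M e.1 e.2 = 1}

/-- The density `p(M) = |M| / (m n)` of a matrix with `m` rows and `n` columns. -/
noncomputable def Matrix.density {α β : Type*} [Fintype α] [Fintype β]
    (M : Matrix α β ℝ) : ℝ :=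
  (M.numOnes : ℝ) / ((Fintype.card α : ℝ) * (Fintype.card β : ℝ))

/-- The submatrix `M[X × Y]` of `M` induced by the rows in `X` and the columns in `Y`. -/
def Matrix.induced {α β : Type*} (M : Matrix α β ℝ) (X : Finset α) (Y : Finset β) :
    Matrix X Y ℝ :=
  M.submatrix (fun x => (x : α)) (fun y => (y : β))

open Finset Matrix

/-! Put `A = M - p`, and let `S` bound `∑ A i j * (x i * y j)` over the cube; up to constants, two
bounds on `S` collide. Low rank makes `S` large: an orthonormal basis of the column space gives `A i
j = ⟨x i, y j⟩` with `|x i|²` of order `r/n` on average and `|y j|²` of order `pn`. So `∑ A i j * ⟨x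
i, y j⟩ = ∑ (A i j)²`, of order `pn²`, is at most of order `√(pr) S` by Grothendieck's inequality,
once rows and columns far above average are discarded (`Matrix.IsBinary.le_cube_bound`). If no
half-size submatrix were sparse, `S` would be small: sums of `A` over such submatrices would be at
least `-D`, hence so would the bilinear form on the hypersimplex, and sign changes make this
two-sided (`cube_bound_of_submatrix_sums`). -/

/-! ### Grothendieck's inequality. -/

/-- Finite Rademacher embedding: `ℝ^d` embeds isometrically into the functions on a finite
probability space with controlled fourth moments. -/
theorem exists_rademacher_embedding (d : ℕ) :
    ∃ (Ω : Type) (_ : Fintype Ω) (_ : Nonempty Ω) (L : (Fin d → ℝ) → Ω → ℝ),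
      (∀ x y, ∑ ω, L x ω * L y ω = Fintype.card Ω * ∑ k, x k * y k) ∧
      ∀ x, ∑ ω, L x ω ^ 4 ≤ 3 * Fintype.card Ω * (∑ k, x k ^ 2) ^ 2 := by
  induction d with
  | zero => exact ⟨Unit, inferInstance, inferInstance, fun _ _ => 0, by simp, by simp⟩
  | succ d ih =>
    obtain ⟨Ω, _, _, L, h2, h4⟩ := ih
    refine ⟨Ω × Bool, inferInstance, inferInstance,
      fun x ω => L (Fin.tail x) ω.1 + (if ω.2 then x 0 else -x 0), fun x y => ?_, fun x => ?_⟩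
    · have h := h2 (Fin.tail x) (Fin.tail y)
      simp only [Fintype.sum_prod_type, Fintype.sum_bool, Fin.sum_univ_succ, Fintype.card_prod,
        Fintype.card_bool, if_true, Bool.false_eq_true, if_false]
      have e : ∀ ω, (L (Fin.tail x) ω + x 0) * (L (Fin.tail y) ω + y 0) +
          (L (Fin.tail x) ω + -x 0) * (L (Fin.tail y) ω + -y 0) =
          2 * (L (Fin.tail x) ω * L (Fin.tail y) ω) + 2 * (x 0 * y 0) := fun ω => by ring
      simp only [e, sum_add_distrib, ← mul_sum, h, sum_const, card_univ, nsmul_eq_mul, Fin.tail]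
      push_cast
      ring
    · have h := h2 (Fin.tail x) (Fin.tail x)
      have h' := h4 (Fin.tail x)
      simp only [Fintype.sum_prod_type, Fintype.sum_bool, Fin.sum_univ_succ, Fintype.card_prod,
        Fintype.card_bool, if_true, Bool.false_eq_true, if_false]
      have e : ∀ ω, (L (Fin.tail x) ω + x 0) ^ 4 + (L (Fin.tail x) ω + -x 0) ^ 4 =
          2 * L (Fin.tail x) ω ^ 4 + 12 * x 0 ^ 2 * (L (Fin.tail x) ω * L (Fin.tail x) ω) +
            2 * x 0 ^ 4 := fun ω => by ring
      simp only [e, sum_add_distrib, ← mul_sum, h, sum_const, card_univ, nsmul_eq_mul]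
      have hs : ∑ k, Fin.tail x k * Fin.tail x k = ∑ k, Fin.tail x k ^ 2 := by simp only [sq]
      have ht : ∑ k : Fin d, x k.succ ^ 2 = ∑ k, Fin.tail x k ^ 2 := rfl
      rw [hs, ht]
      push_cast
      nlinarith [show (0 : ℝ) ≤ Fintype.card Ω * x 0 ^ 4 by positivity]

variable {α β : Type*} [Fintype α] [Fintype β]

/-- The values of `∑ A i j ⟨x i, y j⟩` for vectors `x i`, `y j` in unit balls. -/
def grothendieckValues (A : Matrix α β ℝ) : Set ℝ :=
  {v | ∃ (d : ℕ) (x : α → Fin d → ℝ) (y : β → Fin d → ℝ),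
    (∀ i, ∑ k, x i k ^ 2 ≤ 1) ∧ (∀ j, ∑ k, y j k ^ 2 ≤ 1) ∧
    v = ∑ i, ∑ j, A i j * ∑ k, x i k * y j k}

theorem grothendieckValues_bddAbove (A : Matrix α β ℝ) : BddAbove (grothendieckValues A) := by
  refine ⟨∑ i, ∑ j, |A i j|, ?_⟩
  rintro _ ⟨d, x, y, hx, hy, rfl⟩
  refine sum_le_sum fun i _ => sum_le_sum fun j _ => ?_
  have h : |∑ k, x i k * y j k| ≤ 1 := by
    have := sum_mul_sq_le_sq_mul_sq univ (x i) (y j)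
    rw [← sq_le_one_iff_abs_le_one]
    exact this.trans (mul_le_one₀ (hx i) (sum_nonneg fun _ _ => sq_nonneg _) (hy j))
  calc _ ≤ |A i j * ∑ k, x i k * y j k| := le_abs_self _
    _ = |A i j| * |∑ k, x i k * y j k| := abs_mul _ _
    _ ≤ |A i j| * 1 := by gcongr
    _ = _ := mul_one _

theorem zero_mem_grothendieckValues (A : Matrix α β ℝ) : 0 ∈ grothendieckValues A :=
  ⟨0, fun _ => 0, fun _ => 0, by simp, by simp, by simp⟩

/-- The bound by the supremum of `grothendieckValues`, for vectors indexed by a finite type. -/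
theorem sum_inner_le_sSup_grothendieckValues (A : Matrix α β ℝ) {Ω : Type*} [Fintype Ω]
    {a b : ℝ} (ha : 0 < a) (hb : 0 < b) (x : α → Ω → ℝ) (y : β → Ω → ℝ)
    (hx : ∀ i, ∑ k, x i k ^ 2 ≤ a ^ 2) (hy : ∀ j, ∑ k, y j k ^ 2 ≤ b ^ 2) :
    ∑ i, ∑ j, A i j * ∑ k, x i k * y j k ≤ a * b * sSup (grothendieckValues A) := by
  have key : (∑ i, ∑ j, A i j * ∑ k, x i k * y j k) / (a * b) ∈ grothendieckValues A := by
    let e := Fintype.equivFin Ω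
    refine ⟨Fintype.card Ω, fun i k => x i (e.symm k) / a, fun j k => y j (e.symm k) / b,
      fun i => ?_, fun j => ?_, ?_⟩
    · rw [e.symm.sum_comp (fun k => (x i k / a) ^ 2)]
      simp only [div_pow, ← sum_div]
      exact (div_le_one (by positivity)).2 (hx i)
    · rw [e.symm.sum_comp (fun k => (y j k / b) ^ 2)]
      simp only [div_pow, ← sum_div]
      exact (div_le_one (by positivity)).2 (hy j)
    · simp only [sum_div]
      refine sum_congr rfl fun i _ => sum_congr rfl fun j _ => ?_
      rw [e.symm.sum_comp (fun k => x i k / a * (y j k / b)), mul_div_assoc, sum_div]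
      simp only [div_mul_div_comm]
  have := le_csSup (grothendieckValues_bddAbove A) key
  rw [div_le_iff₀ (by positivity)] at this
  linarith

/-- Inner products are averages of products of Rademacher sums, each cut at height 8. The bounded
parts cost `64 * S` pointwise. By the fourth moment the tails have squared norm at most `3/64 ≤
1/16`, so each of the two tail terms costs at most `γ / 4`, which is absorbed. -/
theorem sSup_grothendieckValues_le (A : Matrix α β ℝ) {S : ℝ}
    (hS : ∀ (x : α → ℝ) (y : β → ℝ), (∀ i, |x i| ≤ 1) → (∀ j, |y j| ≤ 1) →
      ∑ i, ∑ j, A i j * (x i * y j) ≤ S) :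
    sSup (grothendieckValues A) ≤ 128 * S := by
  set γ := sSup (grothendieckValues A) with hγ
  suffices h : γ ≤ 64 * S + γ / 2 by linarith
  refine csSup_le ⟨0, zero_mem_grothendieckValues A⟩ ?_
  rintro _ ⟨d, x, y, hx, hy, rfl⟩
  obtain ⟨Ω, _, _, L, h2, h4⟩ := exists_rademacher_embedding d
  have hN : (0 : ℝ) < Fintype.card Ω := by exact_mod_cast Fintype.card_pos
  obtain ⟨N, hNdef⟩ : ∃ N : ℝ, N = Fintype.card Ω := ⟨_, rfl⟩
  rw [← hNdef] at hN
  simp only [← hNdef] at h2 h4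
  let lo : ℝ → ℝ := fun t => if |t| ≤ 8 then t else 0
  let hi : ℝ → ℝ := fun t => if |t| ≤ 8 then 0 else t
  have hlo8 : ∀ t, |lo t| ≤ 8 := fun t => by
    simp only [lo]; split_ifs with h
    · exact h
    · simp
  have hlosq : ∀ t, lo t ^ 2 ≤ t ^ 2 := fun t => by
    simp only [lo]; split_ifs <;> nlinarith [sq_nonneg t]
  have hhisq : ∀ t, hi t ^ 2 ≤ t ^ 4 / 64 := fun t => by
    simp only [hi]; split_ifs with h
    · rw [zero_pow two_ne_zero]; positivity
    · have : (64 : ℝ) ≤ t ^ 2 := by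
        rw [← sq_abs]; nlinarith [not_le.1 h]
      nlinarith [sq_nonneg t]
  have hadd : ∀ t, t = lo t + hi t := fun t => by simp only [lo, hi]; split_ifs <;> simp
  have hL2 : ∀ z : Fin d → ℝ, ∑ k, z k ^ 2 ≤ 1 → ∑ ω, L z ω ^ 2 ≤ √N ^ 2 := fun z hz => by
    rw [Real.sq_sqrt hN.le]
    have := h2 z z
    simp only [← sq] at this
    rw [this]
    nlinarith
  have hlo2 : ∀ z : Fin d → ℝ, ∑ k, z k ^ 2 ≤ 1 → ∑ ω, lo (L z ω) ^ 2 ≤ √N ^ 2 :=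
    fun z hz => (sum_le_sum fun ω _ => hlosq _).trans (hL2 z hz)
  have hhi2 : ∀ z : Fin d → ℝ, ∑ k, z k ^ 2 ≤ 1 → ∑ ω, hi (L z ω) ^ 2 ≤ (√N / 4) ^ 2 :=
    fun z hz => by
      rw [div_pow, Real.sq_sqrt hN.le]
      have h0 : (0 : ℝ) ≤ ∑ k, z k ^ 2 := sum_nonneg fun _ _ => sq_nonneg _
      have h1 : ∑ ω, hi (L z ω) ^ 2 ≤ (∑ ω, L z ω ^ 4) / 64 := by
        rw [sum_div]; exact sum_le_sum fun ω _ => hhisq _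
      have h3 := h4 z
      have h5 : 3 * N * (∑ k, z k ^ 2) ^ 2 ≤ 3 * N * 1 := by
        gcongr
        exact pow_le_one₀ h0 hz
      linarith
  have hsN : 0 < √N := Real.sqrt_pos.2 hN
  have e1 := sum_inner_le_sSup_grothendieckValues A (by positivity : 0 < √N / 4) hsN
    (fun i ω => hi (L (x i) ω)) (fun j ω => L (y j) ω) (fun i => hhi2 _ (hx i))
    (fun j => hL2 _ (hy j))
  have e2 := sum_inner_le_sSup_grothendieckValues A hsN (by positivity : 0 < √N / 4)
    (fun i ω => lo (L (x i) ω)) (fun j ω => hi (L (y j) ω)) (fun i => hlo2 _ (hx i))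
    (fun j => hhi2 _ (hy j))
  have e3 : ∑ i, ∑ j, A i j * ∑ ω, lo (L (x i) ω) * lo (L (y j) ω) ≤ N * (64 * S) := by
    have : ∀ ω, ∑ i, ∑ j, A i j * (lo (L (x i) ω) * lo (L (y j) ω)) ≤ 64 * S := fun ω => by
      have := hS (fun i => lo (L (x i) ω) / 8) (fun j => lo (L (y j) ω) / 8)
        (fun i => by rw [abs_div, abs_of_pos (by norm_num : (0 : ℝ) < 8)]; linarith [hlo8 (L (x i) ω)])
        (fun i => by rw [abs_div, abs_of_pos (by norm_num : (0 : ℝ) < 8)]; linarith [hlo8 (L (y i) ω)])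
      have e : ∑ i, ∑ j, A i j * (lo (L (x i) ω) * lo (L (y j) ω)) =
          64 * ∑ i, ∑ j, A i j * (lo (L (x i) ω) / 8 * (lo (L (y j) ω) / 8)) := by
        simp only [mul_sum]
        exact sum_congr rfl fun i _ => sum_congr rfl fun j _ => by ring
      rw [e]; linarith
    calc _ = ∑ ω, ∑ i, ∑ j, A i j * (lo (L (x i) ω) * lo (L (y j) ω)) := by
          simp only [mul_sum]
          rw [sum_comm (s := univ (α := Ω))]
          refine sum_congr rfl fun i _ => ?_
          rw [sum_comm]
      _ ≤ ∑ _ω : Ω, 64 * S := sum_le_sum fun ω _ => this ω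
      _ = _ := by simp [hNdef]
  have tot : N * ∑ i, ∑ j, A i j * ∑ k, x i k * y j k =
      (∑ i, ∑ j, A i j * ∑ ω, hi (L (x i) ω) * L (y j) ω) +
      (∑ i, ∑ j, A i j * ∑ ω, lo (L (x i) ω) * hi (L (y j) ω)) +
      ∑ i, ∑ j, A i j * ∑ ω, lo (L (x i) ω) * lo (L (y j) ω) := by
    simp only [← sum_add_distrib, mul_sum (a := N), ← mul_add]
    refine sum_congr rfl fun i _ => sum_congr rfl fun j _ => ?_
    rw [mul_left_comm, ← h2]
    congr 1
    refine sum_congr rfl fun ω _ => ?_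
    have ha := hadd (L (x i) ω)
    have hb := hadd (L (y j) ω)
    calc L (x i) ω * L (y j) ω = (lo (L (x i) ω) + hi (L (x i) ω)) * L (y j) ω := by rw [← ha]
      _ = hi (L (x i) ω) * L (y j) ω + lo (L (x i) ω) * (lo (L (y j) ω) + hi (L (y j) ω)) := by
        rw [← hb]; ring
      _ = _ := by ring
  have hss : √N * √N = N := Real.mul_self_sqrt hN.le
  have e1' : √N / 4 * √N * γ = N * (γ / 4) := by linear_combination (γ / 4) * hss
  have e2' : √N * (√N / 4) * γ = N * (γ / 4) := by linear_combination (γ / 4) * hss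
  rw [← hγ] at e1 e2
  have : N * ∑ i, ∑ j, A i j * ∑ k, x i k * y j k ≤ N * (64 * S + γ / 2) := by
    rw [tot]; nlinarith
  exact le_of_mul_le_mul_left this hN

/-- Grothendieck's inequality (with constant `128`). -/
theorem sum_inner_le_of_cube_bound (A : Matrix α β ℝ) {S : ℝ}
    (hS : ∀ (x : α → ℝ) (y : β → ℝ), (∀ i, |x i| ≤ 1) → (∀ j, |y j| ≤ 1) →
      ∑ i, ∑ j, A i j * (x i * y j) ≤ S) {Ω : Type*} [Fintype Ω]
    {a b : ℝ} (ha : 0 < a) (hb : 0 < b) (x : α → Ω → ℝ) (y : β → Ω → ℝ)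
    (hx : ∀ i, ∑ k, x i k ^ 2 ≤ a ^ 2) (hy : ∀ j, ∑ k, y j k ^ 2 ≤ b ^ 2) :
    ∑ i, ∑ j, A i j * ∑ k, x i k * y j k ≤ 128 * (a * b * S) := by
  have h1 := sum_inner_le_sSup_grothendieckValues A ha hb x y hx hy
  have h2 := mul_le_mul_of_nonneg_left (sSup_grothendieckValues_le A hS) (mul_pos ha hb).le
  linarith

/-! ### Low rank forces a large cube norm. -/

/-- Factorization through an orthonormal basis of the column space. -/
theorem Matrix.exists_orthonormal_factorization {n : ℕ} (A : Matrix (Fin n) β ℝ) :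
    ∃ (x : Fin n → Fin A.rank → ℝ) (y : β → Fin A.rank → ℝ),
      (∀ i j, A i j = ∑ k, x i k * y j k) ∧ (∑ i, ∑ k, x i k ^ 2 = A.rank) ∧
      ∀ j, ∑ k, y j k ^ 2 = ∑ i, A i j ^ 2 := by
  classical
  let c : β → EuclideanSpace ℝ (Fin n) := fun j => WithLp.toLp 2 (fun i => A i j)
  let W : Submodule ℝ (EuclideanSpace ℝ (Fin n)) := Submodule.span ℝ (Set.range c)
  have hW : Module.finrank ℝ W = A.rank := by
    rw [Matrix.rank_eq_finrank_span_cols]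
    have : W = (Submodule.span ℝ (Set.range A.col)).map
        (WithLp.linearEquiv 2 ℝ (Fin n → ℝ)).symm.toLinearMap := by
      rw [Submodule.map_span, ← Set.range_comp]; rfl
    rw [this]
    exact LinearEquiv.finrank_map_eq _ _
  let e := (stdOrthonormalBasis ℝ W).reindex (finCongr hW)
  have hc : ∀ j, c j ∈ W := fun j => Submodule.subset_span ⟨j, rfl⟩
  refine ⟨fun i k => (e k : EuclideanSpace ℝ (Fin n)) i, fun j k => inner ℝ (e k) ⟨c j, hc j⟩,
    fun i j => ?_, ?_, fun j => ?_⟩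
  · have h := e.sum_repr' ⟨c j, hc j⟩
    have h' := congrArg (fun w : W => (w : EuclideanSpace ℝ (Fin n)) i) h
    simp only [Submodule.coe_sum, Submodule.coe_smul, WithLp.ofLp_sum, Finset.sum_apply,
      PiLp.smul_apply, smul_eq_mul] at h'
    rw [show A i j = (c j) i from rfl, ← h']
    exact sum_congr rfl fun k _ => mul_comm _ _
  · rw [sum_comm]
    have : ∀ k, ∑ i, (e k : EuclideanSpace ℝ (Fin n)) i ^ 2 = 1 := fun k => by
      rw [← EuclideanSpace.real_norm_sq_eq, ← Submodule.coe_norm, e.orthonormal.1 k, one_pow]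
    simp [this]
  · have h := e.sum_sq_norm_inner_right ⟨c j, hc j⟩
    simp only [Real.norm_eq_abs, sq_abs] at h
    rw [h, Submodule.coe_norm, EuclideanSpace.real_norm_sq_eq]

theorem Matrix.rank_add_le {α β : Type*} [Fintype α] [Fintype β] (A B : Matrix α β ℝ) :
    (A + B).rank ≤ A.rank + B.rank := by
  have h : LinearMap.range (A + B).mulVecLin ≤
      LinearMap.range A.mulVecLin ⊔ LinearMap.range B.mulVecLin := by
    rintro _ ⟨v, rfl⟩
    rw [Matrix.mulVecLin_add, LinearMap.add_apply]
    exact Submodule.add_mem_sup ⟨v, rfl⟩ ⟨v, rfl⟩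
  exact (Submodule.finrank_mono h).trans (Submodule.finrank_add_le_finrank_add_finrank _ _)

/-- A surviving one contributes `(1 - p)² ≥ 1/4`, whence the factor 4; a discarded one makes the
left side nonpositive. -/
theorem one_entry_bound {p u v w m : ℝ} (hp : p ≤ 1 / 2) (hu : u = 0 ∨ u = 1)
    (hv : v = 0 ∨ v = 1) (hw : w = 0 ∨ w = 1) (hm : m = 0 ∨ m = 1) :
    m - u * m - (1 - u) * w * m - v * m ≤
      4 * ((m - p) * ((1 - u) * (1 - w) * (1 - v) * (m - p))) := by
  rcases hu with rfl | rfl <;> rcases hv with rfl | rfl <;> rcases hw with rfl | rfl <;>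
    rcases hm with rfl | rfl <;> norm_num <;> nlinarith

/-- Used with `t = √(pr)` and `P = pn²`: the lower bound on `p` keeps `t` away from 0, so the loss
`4 * S` is absorbed into `S * t`. -/
theorem cube_bound_contradiction {t P S G : ℝ} (ht : 0 < t) (ht1 : 1 ≤ 8 * t ^ 2) (hS : 0 ≤ S)
    (h : 10000 * S * t < P) (h1 : P - 2 * S - P / 4 - 2 * S ≤ 4 * G)
    (h2 : G ≤ 128 * (8 * t * S)) : False := by
  have h3 : 1 ≤ 3 * t := by nlinarith
  have h4 : S ≤ 3 * (S * t) := by nlinarith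
  have h5 : 0 ≤ S * t := mul_nonneg hS ht.le
  linarith

/-- A binary matrix of low rank and density `p` has large centred cube norm. -/
theorem Matrix.IsBinary.le_cube_bound {n r : ℕ} {M : Matrix (Fin n) (Fin n) ℝ} {p S : ℝ}
    (hn : 0 < n) (hr : 0 < r) (hM : M.IsBinary) (hrank : M.rank ≤ r)
    (hp : ∑ i, ∑ j, M i j = p * n ^ 2) (hp1 : 1 / (8 * (r : ℝ)) ≤ p) (hp2 : p ≤ 1 / 2)
    (hS : ∀ x y : Fin n → ℝ, (∀ i, |x i| ≤ 1) → (∀ j, |y j| ≤ 1) →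
      ∑ i, ∑ j, (M i j - p) * (x i * y j) ≤ S) :
    √p / √(r : ℝ) * n ^ 2 ≤ 10000 * S := by
  have hn' : (0 : ℝ) < n := by exact_mod_cast hn
  have hr' : (1 : ℝ) ≤ r := by exact_mod_cast hr
  have hr0 : (0 : ℝ) < r := by linarith
  have hp0 : 0 < p := lt_of_lt_of_le (by positivity) hp1
  by_contra! hlt
  let A : Matrix (Fin n) (Fin n) ℝ := fun i j => M i j - p
  have hA : A.rank ≤ 2 * r := by
    have h1 : A = M + vecMulVec (fun _ => -p) (fun _ => 1) := by
      ext i j; simp [A, vecMulVec_apply, sub_eq_add_neg]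
    have h2 := rank_add_le M (vecMulVec (fun _ : Fin n => -p) (fun _ : Fin n => 1))
    have h3 := rank_vecMulVec_le (fun _ : Fin n => -p) (fun _ : Fin n => (1 : ℝ))
    rw [h1]; omega
  have hA' : (A.rank : ℝ) ≤ 2 * r := by exact_mod_cast hA
  obtain ⟨x, y, hxy, hx, hy⟩ := A.exists_orthonormal_factorization
  let u : Fin n → ℝ := fun i => if ∑ j, M i j ≤ 2 * p * n then 0 else 1
  let v : Fin n → ℝ := fun j => if ∑ i, M i j ≤ 2 * p * n then 0 else 1
  let w : Fin n → ℝ := fun i => if ∑ k, x i k ^ 2 ≤ 16 * r / n then 0 else 1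
  have h01 : ∀ i, (u i = 0 ∨ u i = 1) ∧ (v i = 0 ∨ v i = 1) ∧ (w i = 0 ∨ w i = 1) := fun i => by
    simp only [u, v, w]; refine ⟨?_, ?_, ?_⟩ <;> split_ifs <;> simp
  -- few ones lie in heavy rows or heavy columns
  have hu : ∑ i, ∑ j, u i * M i j ≤ 2 * S := by
    have h := hS u (fun _ => 1) (fun i => by rcases (h01 i).1 with h | h <;> simp [h]) (by simp)
    -- A heavy row has at most twice as many ones as its excess over `pn`.
    have h' : ∑ i, ∑ j, u i * M i j ≤ 2 * ∑ i, ∑ j, (M i j - p) * (u i * 1) := by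
      rw [mul_sum]
      refine sum_le_sum fun i _ => ?_
      rw [← mul_sum, ← sum_mul, sum_sub_distrib]
      simp only [sum_const, card_univ, Fintype.card_fin, nsmul_eq_mul, u]
      split_ifs with hi
      · simp
      · push Not at hi; linarith
    linarith
  have hv : ∑ i, ∑ j, v j * M i j ≤ 2 * S := by
    have h := hS (fun _ => 1) v (by simp) (fun i => by rcases (h01 i).2.1 with h | h <;> simp [h])
    have h' : ∑ i, ∑ j, v j * M i j ≤ 2 * ∑ i, ∑ j, (M i j - p) * (1 * v j) := by
      rw [sum_comm (f := fun i j => v j * M i j),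
        sum_comm (f := fun i j => (M i j - p) * (1 * v j)), mul_sum]
      refine sum_le_sum fun j _ => ?_
      rw [← mul_sum, ← sum_mul, sum_sub_distrib]
      simp only [sum_const, card_univ, Fintype.card_fin, nsmul_eq_mul, v]
      split_ifs with hj
      · simp
      · push Not at hj; linarith
    linarith
  -- Markov's inequality: the squared lengths sum to `A.rank ≤ 2r`.
  have hwcard : ∑ i, w i ≤ n / 8 := by
    have h : ∑ i, w i * (16 * r / n) ≤ ∑ i, ∑ k, x i k ^ 2 := sum_le_sum fun i _ => by
      simp only [w]
      split_ifs with hi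
      · rw [zero_mul]; exact sum_nonneg fun _ _ => sq_nonneg _
      · push Not at hi; linarith
    rw [← sum_mul, hx, mul_div_assoc', div_le_iff₀ hn'] at h
    have : (∑ i, w i) * (16 * r) ≤ n / 8 * (16 * r) := by nlinarith
    exact le_of_mul_le_mul_right this (by positivity)
  have hw : ∑ i, ∑ j, (1 - u i) * w i * M i j ≤ p * n ^ 2 / 4 := by
    have h : ∑ i, ∑ j, (1 - u i) * w i * M i j ≤ ∑ i, w i * (2 * p * n) :=
      sum_le_sum fun i _ => by
        rw [← mul_sum]
        have : 0 ≤ w i := by rcases (h01 i).2.2 with h | h <;> simp [h]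
        simp only [u]
        split_ifs with hi
        · rw [sub_zero, one_mul]; gcongr
        · simp only [sub_self, zero_mul]; positivity
    rw [← sum_mul] at h
    have h2 : (∑ i, w i) * (2 * p * n) ≤ n / 8 * (2 * p * n) := by gcongr
    linarith
  have hgood : p * n ^ 2 - 2 * S - p * n ^ 2 / 4 - 2 * S ≤
      4 * ∑ i, ∑ j, A i j * ∑ k, ((1 - u i) * (1 - w i) * x i k) * ((1 - v j) * y j k) := by
    have h : ∑ i, ∑ j, (M i j - u i * M i j - (1 - u i) * w i * M i j - v j * M i j) ≤
        4 * ∑ i, ∑ j, A i j * ∑ k, ((1 - u i) * (1 - w i) * x i k) * ((1 - v j) * y j k) := by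
      simp only [mul_sum (a := (4 : ℝ))]
      refine sum_le_sum fun i _ => sum_le_sum fun j _ => ?_
      have e : ∑ k, ((1 - u i) * (1 - w i) * x i k) * ((1 - v j) * y j k) =
          (1 - u i) * (1 - w i) * (1 - v j) * A i j := by
        rw [hxy, mul_sum]
        exact sum_congr rfl fun k _ => by ring
      rw [e]
      exact one_entry_bound hp2 (h01 i).1 (h01 j).2.1 (h01 i).2.2 (hM i j)
    simp only [sum_sub_distrib] at h
    rw [hp] at h
    linarith
  have hs0 : 0 < √p := Real.sqrt_pos.2 hp0
  have hρ0 : 0 < √(r : ℝ) := Real.sqrt_pos.2 hr0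
  have hν0 : 0 < √(n : ℝ) := Real.sqrt_pos.2 hn'
  have hs : √p ^ 2 = p := Real.sq_sqrt hp0.le
  have hρ : √(r : ℝ) ^ 2 = r := Real.sq_sqrt hr0.le
  have hν : √(n : ℝ) ^ 2 = n := Real.sq_sqrt hn'.le
  -- A column kept by `v` has squared norm at most `2pn + np² ≤ 4pn`; `n` cancels in the product of
  -- the two radii.
  have hG := sum_inner_le_of_cube_bound A hS
    (by positivity : 0 < 4 * √(r : ℝ) / √(n : ℝ)) (by positivity : 0 < 2 * √p * √(n : ℝ))
    (fun i k => (1 - u i) * (1 - w i) * x i k) (fun j k => (1 - v j) * y j k)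
    (fun i => by
      simp only [mul_pow, div_pow, hρ, hν, ← mul_sum]
      have h0 : (0 : ℝ) ≤ 16 * r / n := by positivity
      have h1 : (1 - u i) ^ 2 ≤ 1 := by rcases (h01 i).1 with h | h <;> simp [h]
      have h2 : (1 - w i) ^ 2 * ∑ k, x i k ^ 2 ≤ 16 * r / n := by
        simp only [w]
        split_ifs with hi
        · simpa using hi
        · simpa using h0
      have h3 : 0 ≤ (1 - w i) ^ 2 * ∑ k, x i k ^ 2 :=
        mul_nonneg (sq_nonneg _) (sum_nonneg fun _ _ => sq_nonneg _)
      norm_num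
      rw [mul_assoc]
      nlinarith)
    (fun j => by
      simp only [mul_pow, hs, hν, ← mul_sum, hy]
      have h1 : ∑ i, A i j ^ 2 ≤ ∑ i, M i j + n * p ^ 2 := by
        have : ∑ i, A i j ^ 2 ≤ ∑ i, (M i j + p ^ 2) := sum_le_sum fun i _ => by
          have hAij : A i j = M i j - p := rfl
          rw [hAij]
          rcases hM i j with h4 | h4 <;> rw [h4] <;> nlinarith
        rw [sum_add_distrib] at this
        simpa using this
      simp only [v]
      split_ifs with hj
      · have : n * p ^ 2 ≤ n * p := by gcongr; nlinarith
        norm_num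
        nlinarith
      · norm_num; positivity)
  have hab : 4 * √(r : ℝ) / √(n : ℝ) * (2 * √p * √(n : ℝ)) = 8 * (√p * √(r : ℝ)) := by
    field_simp; norm_num
  rw [hab] at hG
  have h3 : 1 ≤ 8 * (√p * √(r : ℝ)) ^ 2 := by
    rw [div_le_iff₀ (by positivity)] at hp1
    rw [mul_pow, hs, hρ]; linarith
  have hS0 : 0 ≤ S := by
    have := hS (fun _ => 0) (fun _ => 0) (by simp) (by simp)
    simpa using this
  have e : √p / √(r : ℝ) * n ^ 2 * (√p * √(r : ℝ)) = p * n ^ 2 := by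
    calc _ = √p ^ 2 * n ^ 2 := by field_simp
      _ = _ := by rw [hs]
  refine cube_bound_contradiction (mul_pos hs0 hρ0) h3 hS0 ?_ hgood hG
  rw [← e]
  exact mul_lt_mul_of_pos_right hlt (mul_pos hs0 hρ0)

/-! ### From submatrix sums to the cube norm. -/

/-- A linear functional on the hypersimplex attains its minimum at a vertex. -/
theorem exists_card_eq_sum_le {n k : ℕ} (hk : 0 < k) (hkn : k ≤ n) (f x : Fin n → ℝ)
    (hx0 : ∀ i, 0 ≤ x i) (hx1 : ∀ i, x i ≤ 1) (hx : ∑ i, x i = k) :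
    ∃ X : Finset (Fin n), X.card = k ∧ ∑ i ∈ X, f i ≤ ∑ i, f i * x i := by
  obtain ⟨X, hX, hmin⟩ := exists_min_image (powersetCard k (univ : Finset (Fin n)))
    (fun X => ∑ i ∈ X, f i) (powersetCard_nonempty.2 (by simpa using hkn))
  have hXc : X.card = k := (mem_powersetCard.1 hX).2
  refine ⟨X, hXc, ?_⟩
  obtain ⟨a, ha, hmax⟩ := exists_max_image X f (card_pos.1 (hXc ▸ hk))
  have hout : ∀ b, b ∉ X → f a ≤ f b := fun b hb => by
    have hb' : b ∉ X.erase a := fun h => hb (mem_of_mem_erase h)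
    have h := hmin (insert b (X.erase a)) (mem_powersetCard.2 ⟨subset_univ _, by
      rw [card_insert_of_notMem hb', card_erase_of_mem ha, hXc]; omega⟩)
    rw [sum_insert hb', ← add_sum_erase X f ha] at h
    linarith
  -- `f a` separates `X` from its complement, and cancels because `x` and the indicator of `X` have
  -- equal sums.
  have key : 0 ≤ ∑ i, (f i - f a) * (x i - if i ∈ X then 1 else 0) := sum_nonneg fun i _ => by
    split_ifs with hi
    · exact mul_nonneg_of_nonpos_of_nonpos (by linarith [hmax i hi]) (by linarith [hx1 i])
    · exact mul_nonneg (by linarith [hout i hi]) (by linarith [hx0 i])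
  simp only [sub_mul, mul_sub, sum_sub_distrib, ← mul_sum, hx] at key
  simp [hXc] at key
  linarith

/-- If all `k × k` submatrix sums of a matrix with total sum zero are at least `-D`, then its
cube norm is at most `72 D`. -/
theorem cube_bound_of_submatrix_sums {n k : ℕ} (hk : 0 < k) (hk1 : 2 * k ≤ n) (hk2 : n ≤ 3 * k)
    (A : Matrix (Fin n) (Fin n) ℝ) (hA : ∑ i, ∑ j, A i j = 0) {D : ℝ}
    (hD : ∀ X Y : Finset (Fin n), X.card = k → Y.card = k → -D ≤ ∑ i ∈ X, ∑ j ∈ Y, A i j)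
    (x y : Fin n → ℝ) (hx : ∀ i, |x i| ≤ 1) (hy : ∀ j, |y j| ≤ 1) :
    ∑ i, ∑ j, A i j * (x i * y j) ≤ 72 * D := by
  have hn : (0 : ℝ) < n := by exact_mod_cast (by omega : 0 < n)
  let F : (Fin n → ℝ) →ₗ[ℝ] (Fin n → ℝ) →ₗ[ℝ] ℝ := Matrix.toLinearMap₂' ℝ A
  have hF : ∀ a b, F a b = ∑ i, ∑ j, A i j * (a i * b j) := fun a b => by
    simp only [F, Matrix.toLinearMap₂'_apply, smul_eq_mul]
    exact sum_congr rfl fun i _ => sum_congr rfl fun j _ => by ring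
  have hvert : ∀ a b : Fin n → ℝ, (∀ i, 0 ≤ a i) → (∀ i, a i ≤ 1) → ∑ i, a i = k →
      (∀ i, 0 ≤ b i) → (∀ i, b i ≤ 1) → ∑ i, b i = k → -D ≤ F a b := by
    intro a b ha0 ha1 ha hb0 hb1 hb
    obtain ⟨X, hX, h1⟩ := exists_card_eq_sum_le hk (by omega) (fun i => ∑ j, A i j * b j) a
      ha0 ha1 ha
    obtain ⟨Y, hY, h2⟩ := exists_card_eq_sum_le hk (by omega) (fun j => ∑ i ∈ X, A i j) b
      hb0 hb1 hb
    have h3 := (hD X Y hX hY).trans_eq sum_comm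
    have e1 : F a b = ∑ i, (∑ j, A i j * b j) * a i := by
      rw [hF]; simp only [sum_mul]
      exact sum_congr rfl fun i _ => sum_congr rfl fun j _ => by ring
    have e2 : ∑ j, (∑ i ∈ X, A i j) * b j = ∑ i ∈ X, ∑ j, A i j * b j := by
      simp only [sum_mul]; exact sum_comm
    rw [e1]; linarith
  let one : Fin n → ℝ := fun _ => 1
  have h11 : F one one = 0 := by rw [hF]; simpa [one] using hA
  obtain ⟨t, ht⟩ : ∃ t : ℝ, t = k / n := ⟨_, rfl⟩
  have ht1 : t ≤ 1 / 2 := by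
    rw [ht, div_le_iff₀ hn]
    have : (2 : ℝ) * k ≤ n := by exact_mod_cast hk1
    linarith
  have ht3 : 1 / 3 ≤ t := by
    rw [ht, le_div_iff₀ hn]
    have : (n : ℝ) ≤ 3 * k := by exact_mod_cast hk2
    linarith
  -- As `t ≤ 1/2`, `t • (one + c)` lies in the hypersimplex for every centred `c` in the cube.
  have hcent : ∀ a b : Fin n → ℝ, (∀ i, |a i| ≤ 1) → ∑ i, a i = 0 →
      (∀ i, |b i| ≤ 1) → ∑ i, b i = 0 → -D ≤ t ^ 2 * (F a one + F one b + F a b) := by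
    intro a b ha ha' hb hb'
    have aux : ∀ c : Fin n → ℝ, (∀ i, |c i| ≤ 1) → ∑ i, c i = 0 →
        (∀ i, 0 ≤ (t • (one + c)) i) ∧ (∀ i, (t • (one + c)) i ≤ 1) ∧
          ∑ i, (t • (one + c)) i = k := by
      intro c hc hc'
      refine ⟨fun i => ?_, fun i => ?_, ?_⟩
      · simp only [Pi.smul_apply, Pi.add_apply, smul_eq_mul, one]
        exact mul_nonneg (by linarith) (by linarith [(abs_le.1 (hc i)).1])
      · simp only [Pi.smul_apply, Pi.add_apply, smul_eq_mul, one]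
        nlinarith [(abs_le.1 (hc i)).2, (abs_le.1 (hc i)).1]
      · simp only [Pi.smul_apply, Pi.add_apply, smul_eq_mul, one, ← mul_sum, sum_add_distrib, hc',
          ht]
        simp only [sum_const, card_univ, Fintype.card_fin, nsmul_eq_mul]
        field_simp
        ring
    obtain ⟨a0, a1, a2⟩ := aux a ha ha'
    obtain ⟨b0, b1, b2⟩ := aux b hb hb'
    have h := hvert _ _ a0 a1 a2 b0 b1 b2
    simp only [map_smul, map_add, LinearMap.add_apply, LinearMap.smul_apply, smul_eq_mul, h11] at h
    nlinarith
  have ht2 : 1 ≤ 9 * t ^ 2 := by nlinarith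
  have neg_abs : ∀ c : Fin n → ℝ, (∀ i, |c i| ≤ 1) → ∀ i, |(-c) i| ≤ 1 := fun c hc i => by
    simpa using hc i
  have scale : ∀ z : ℝ, -D ≤ t ^ 2 * z → -D ≤ t ^ 2 * (-z) → |z| ≤ 9 * D := by
    intro z h1 h2
    rw [abs_le]; constructor <;> nlinarith [abs_nonneg z]
  have z0 : ∀ i, |(0 : Fin n → ℝ) i| ≤ 1 := by simp
  have z0' : ∑ i, (0 : Fin n → ℝ) i = 0 := by simp
  have hFa : ∀ a : Fin n → ℝ, (∀ i, |a i| ≤ 1) → ∑ i, a i = 0 → |F a one| ≤ 9 * D := by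
    intro a ha ha'
    have h1 := hcent a 0 ha ha' z0 z0'
    have h2 := hcent (-a) 0 (neg_abs a ha) (by simpa using ha') z0 z0'
    simp only [map_zero, map_neg, LinearMap.neg_apply, add_zero] at h1 h2
    exact scale _ h1 h2
  have hFb : ∀ b : Fin n → ℝ, (∀ i, |b i| ≤ 1) → ∑ i, b i = 0 → |F one b| ≤ 9 * D := by
    intro b hb hb'
    have h1 := hcent 0 b z0 z0' hb hb'
    have h2 := hcent 0 (-b) z0 z0' (neg_abs b hb) (by simpa using hb')
    simp only [map_zero, map_neg, LinearMap.zero_apply, add_zero, zero_add,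
      neg_zero] at h1 h2
    exact scale _ h1 h2
  have hFab : ∀ a b : Fin n → ℝ, (∀ i, |a i| ≤ 1) → ∑ i, a i = 0 →
      (∀ i, |b i| ≤ 1) → ∑ i, b i = 0 → |F a b| ≤ 9 * D := by
    intro a b ha ha' hb hb'
    have h1 := hcent a b ha ha' hb hb'
    have h2 := hcent (-a) (-b) (neg_abs a ha) (by simpa using ha') (neg_abs b hb)
      (by simpa using hb')
    have h3 := hcent (-a) b (neg_abs a ha) (by simpa using ha') hb hb'
    have h4 := hcent a (-b) ha ha' (neg_abs b hb) (by simpa using hb')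
    simp only [map_neg, LinearMap.neg_apply, neg_neg] at h1 h2 h3 h4
    -- Averaging over a simultaneous sign change cancels the two linear terms.
    exact scale _ (by linarith) (by linarith)
  -- Centring can double the sup norm, hence the factor 2; expanding the form then gives `(4 + 2 +
  -- 2) * 9 = 72`.
  have hdec : ∀ c : Fin n → ℝ, (∀ i, |c i| ≤ 1) → ∃ (e : ℝ) (c' : Fin n → ℝ), |e| ≤ 1 ∧
      (∀ i, |c' i| ≤ 1) ∧ ∑ i, c' i = 0 ∧ c = (2 : ℝ) • c' + e • one := by
    intro c hc
    have he : |(∑ i, c i) / n| ≤ 1 := by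
      rw [abs_div, abs_of_pos hn, div_le_one hn]
      calc |∑ i, c i| ≤ ∑ i, |c i| := abs_sum_le_sum_abs _ _
        _ ≤ ∑ _i : Fin n, (1 : ℝ) := sum_le_sum fun i _ => hc i
        _ = n := by simp
    refine ⟨(∑ i, c i) / n, fun i => (c i - (∑ i, c i) / n) / 2, he, fun i => ?_, ?_, ?_⟩
    · have h1 := abs_le.1 (hc i)
      have h2 := abs_le.1 he
      exact abs_le.2 ⟨by linarith, by linarith⟩
    · rw [← sum_div, sum_sub_distrib]
      simp only [sum_const, card_univ, Fintype.card_fin, nsmul_eq_mul]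
      field_simp
      ring
    · ext i
      simp only [Pi.add_apply, Pi.smul_apply, smul_eq_mul, one]
      ring
  obtain ⟨e, a, he, ha, ha', hxa⟩ := hdec x hx
  obtain ⟨d, b, hd, hb, hb', hyb⟩ := hdec y hy
  rw [← hF, hxa, hyb]
  simp only [map_smul, map_add, LinearMap.add_apply, LinearMap.smul_apply, smul_eq_mul, h11]
  have g1 := le_abs_self (F a b)
  have g2 : d * F a one ≤ 9 * D := (le_abs_self _).trans (by
    rw [abs_mul]; nlinarith [hFa a ha ha', abs_nonneg (F a one)])
  have g3 : e * F one b ≤ 9 * D := (le_abs_self _).trans (by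
    rw [abs_mul]; nlinarith [hFb b hb hb', abs_nonneg (F one b)])
  have g4 := hFab a b ha ha' hb hb'
  linarith

/-! ### Densities and the conclusion. -/

theorem Matrix.IsBinary.numOnes_eq_sum {α β : Type*} [Fintype α] [Fintype β] {M : Matrix α β ℝ}
    (hM : M.IsBinary) : (M.numOnes : ℝ) = ∑ i, ∑ j, M i j := by
  classical
  rw [Matrix.numOnes, Nat.card_eq_fintype_card, Fintype.card_subtype, card_filter,
    ← Fintype.sum_prod_type' (f := fun i j => M i j)]
  push_cast
  refine sum_congr rfl fun e _ => ?_
  rcases hM e.1 e.2 with h | h <;> simp [h]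

theorem mainTheorem4 :
    ∃ c : ℝ, 0 < c ∧
      ∀ (n r : ℕ) (M : Matrix (Fin n) (Fin n) ℝ),
        0 < r → M.IsBinary → M.rank ≤ r →
        1 / (8 * (r : ℝ)) ≤ M.density → M.density ≤ 1 / 2 →
        ∃ X Y : Finset (Fin n), X.card = n / 2 ∧ Y.card = n / 2 ∧
          (M.induced X Y).density ≤ M.density - c * (√M.density / √(r : ℝ)) := by
  -- Any constant below `1 / (72 * 10000)` would do.
  refine ⟨1 / 1000000, by norm_num, fun n r M hr hM hrank hp1 hp2 => ?_⟩
  have hr0 : (0 : ℝ) < r := by exact_mod_cast hr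
  have hdens : M.density = (∑ i, ∑ j, M i j) / ((n : ℝ) * n) := by
    rw [Matrix.density, hM.numOnes_eq_sum, Fintype.card_fin]
  have hp0 : 0 < M.density := lt_of_lt_of_le (by positivity) hp1
  -- For `n = 0` the density is `0 / 0 = 0`; for `n = 1` it is 0 or 1. From `n ≥ 2` follows `n ≤ 3 *
  -- (n / 2)`.
  have hn : 2 ≤ n := by
    by_contra! h
    interval_cases n
    · rw [hdens] at hp0; simp at hp0
    · rw [hdens] at hp0 hp2
      rcases hM 0 0 with h | h <;> simp [h] at hp0 hp2
      norm_num at hp2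
  obtain ⟨p, hp⟩ : ∃ p, p = M.density := ⟨_, rfl⟩
  rw [← hp] at hdens hp0 hp1 hp2 ⊢
  have hn' : (0 : ℝ) < n := by exact_mod_cast (by omega : 0 < n)
  have hsum : ∑ i, ∑ j, M i j = p * n ^ 2 := by rw [hdens]; field_simp
  obtain ⟨k, hk⟩ : ∃ k, k = n / 2 := ⟨_, rfl⟩
  rw [← hk]
  have hk0 : 0 < k := by omega
  have hk' : (0 : ℝ) < k := by exact_mod_cast hk0
  have hkn : (k : ℝ) ≤ n := by exact_mod_cast (by omega : k ≤ n)
  have hq : 0 < √p / √(r : ℝ) := div_pos (Real.sqrt_pos.2 hp0) (Real.sqrt_pos.2 hr0)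
  by_contra! hcon
  have hcube := cube_bound_of_submatrix_sums hk0 (by omega) (by omega) (fun i j => M i j - p)
    (by simp [sum_sub_distrib, hsum]; ring) (D := 1 / 1000000 * (√p / √(r : ℝ)) * n ^ 2)
    (fun X Y hX hY => by
      have h := hcon X Y hX hY
      have hb : (M.induced X Y).IsBinary := fun i j => hM _ _
      rw [Matrix.density, hb.numOnes_eq_sum, Fintype.card_coe, Fintype.card_coe, hX, hY,
        lt_div_iff₀ (by positivity)] at h
      have e : ∑ i, ∑ j, M.induced X Y i j = ∑ i ∈ X, ∑ j ∈ Y, M i j := by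
        simp only [Matrix.induced, Matrix.submatrix_apply]
        rw [← sum_coe_sort X]
        exact sum_congr rfl fun i _ => sum_coe_sort Y (fun j => M i j)
      rw [e] at h
      simp only [sum_sub_distrib, sum_const, hX, hY, nsmul_eq_mul]
      have : (√p / √(r : ℝ)) * ((k : ℝ) * k) ≤ (√p / √(r : ℝ)) * n ^ 2 := by
        gcongr; nlinarith
      linarith)
  have := hM.le_cube_bound (by omega) hr hrank hsum hp1 hp2 hcube
  have h0 : 0 < √p / √(r : ℝ) * n ^ 2 := by positivity
  linarith
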